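/- Let $\operatorname{Log}$ be the principal logarithm on $\mathcal A=\mathbb C\setminus(-\infty,0]$ and let $$G(z)=\Bigl(1-\frac{\operatorname{Log} z}{\operatorname{Log}(1+z)}\Bigr)z\operatorname{Log} z,\qquad z\in\mathcal A.$$ Let $$\rho(t)=\begin{cases}-\dfrac{t\ln((1-t)/t^2)}{\ln(1-t)}, & 0<t<1,\\[2mm] -1, & t=1,\\[1mm] -\dfrac{t\,(\ln((t-1)/t))^2}{(\ln(t-1))^2+\pi^2}, & t>1,\end{cases}\qquad \varphi(s)=\int_0^\infty e^{-st}\rho(t)\,dt,\quad s\ge 0.$$ A function $F:\mathbb R\to\mathbb C$ is called positive definite if for all $n$ and all $x_1,\dots,x_n\in\mathbb R$ the matrix $(F(x_i-x_j))_{i,j}$ is Hermitian positive semidefinite, and negative definite if for all $n$ and all $x_1,\dots,x_n\in\mathbb R$ the matrix $(F(x_i)+\overline{F(x_j)}-F(x_i-x_j))_{i,j}$ is Hermitian positive semidefinite. The integral defining $\varphi(s)$ converges absolutely for every $s\ge 0$, and the following hold. (i) For each $a>0$, the function $t\mapsto 1-G(a+it)$ is real-analytic and positive definite on $\mathbb R$,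 and it is the Fourier transform of the integrable function $s\mapsto e^{-as}\varphi(s)1_{[0,\infty)}(s)$, that is, $$1-G(a+it)=\int_0^\infty e^{-its}e^{-as}\varphi(s)\,ds,\qquad t\in\mathbb R.$$ (ii) For each $a>0$, the function $t\mapsto G(a+it)-G(a)$ is continuous and negative definite on $\mathbb R$. In particular, $G(a)$ being real, $\operatorname{Re}G(a+it)\ge G(a)$ for all $t\in\mathbb R$. (iii) For each $a\ge 1$, the function $t\mapsto G(a+it)$ is continuous and negative definite on $\mathbb R$. -/

import Mathlib

open MeasureTheory Set
open scoped ComplexOrder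

noncomputable section

namespace AlzerG

/-- The function `G(z) = (1 - Log z / Log (1 + z)) z Log z` (principal logarithm). -/
def G (z : ℂ) : ℂ :=
  (1 - Complex.log z / Complex.log (1 + z)) * z * Complex.log z

/-- The function `ρ` on the positive half-line, extended continuously by `-1` at `1`.
Its values outside `(0, ∞)` are never used. -/
def rho (t : ℝ) : ℝ :=
  if t < 1 then -(t * Real.log ((1 - t) / t ^ 2) / Real.log (1 - t))
  else if t = 1 then -1
  else -(t * Real.log ((t - 1) / t) ^ 2 / (Real.log (t - 1) ^ 2 + Real.pi ^ 2))

/-- The Laplace transform `φ(s) = ∫₀^∞ e^{-st} ρ(t) dt`. -/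
def phi (s : ℝ) : ℝ :=
  ∫ t in Ioi (0 : ℝ), Real.exp (-s * t) * rho t

/-- The function `s ↦ e^{-as} φ(s) 1_{[0,∞)}(s)` on the real line. -/
def density (a : ℝ) : ℝ → ℝ :=
  indicator (Ici (0 : ℝ)) (fun s => Real.exp (-a * s) * phi s)

/-- The Fourier transform `t ↦ ∫ e^{-its} f(s) ds` of a real-valued function on the line. -/
def fourierTransform (f : ℝ → ℝ) (t : ℝ) : ℂ :=
  ∫ s : ℝ, Complex.exp (-(Complex.I * t * s)) * (f s : ℂ)

/-- `f : ℝ → ℂ` is positive definite if all the matrices `(f (x i - x j))` are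
Hermitian and positive semidefinite. -/
def IsPositiveDefinite (f : ℝ → ℂ) : Prop :=
  ∀ (n : ℕ) (x : Fin n → ℝ), (Matrix.of fun i j => f (x i - x j)).PosSemidef

/-- `f : ℝ → ℂ` is negative definite (in the sense of Schoenberg) if all the matrices
`(f (x i) + conj (f (x j)) - f (x i - x j))` are Hermitian and positive semidefinite. -/
def IsNegativeDefinite (f : ℝ → ℂ) : Prop :=
  ∀ (n : ℕ) (x : Fin n → ℝ),
    (Matrix.of fun i j => f (x i) + starRingEnd ℂ (f (x j)) - f (x i - x j)).PosSemidef

end AlzerG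

end

noncomputable section

namespace AlzerG

open Filter Topology

/-! ### Integration on the half-line and on the boundary of the upper half-plane -/

/-! Everything reduces to showing that `1 - G` is the Laplace transform of a nonnegative function on
the half-line.

Near `0`, `1 - G` is bounded by a multiple of `‖w‖ ^ (-1/2)`; at infinity it decays like `1 / ‖w‖`.
Cauchy's theorem in the upper half-plane then gives a Stieltjes representation `1 - G z = ∫ rho t /
(t + z)`, where `π * rho t` is the imaginary part of the boundary value of `G` at `-t` from above
(`G_neg_im`, `one_sub_G_eq_integral_of_im_pos`). Writing `1 / (t + z)` as the Laplace integral of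
`exp (-s (t + z))` and applying Fubini turns this into `1 - G z = ∫ exp (-z s) phi s ds`;
conjugation covers the lower half-plane and continuity the real axis.

The density `rho` is not of one sign, but `phi` is nonnegative (`phi_nonneg`): `rho` changes sign
once, from plus to minus, and its total integral is the limit of `a (1 - G a)` as `a → ∞`, which is
nonnegative because `G a ≤ 1` for `a ≥ 1`.

Hence `1 - G (a + it)` is the Fourier transform of a nonnegative integrable density and so positive
definite, while `G (a + it) - G a` is the integral of `1 - exp (-its)` against that density and so
negative definite. For `a ≥ 1` the constant `G a ≥ 0` may be added back. -/

theorem integrableOn_Ioi_zero_of_bounds {E : Type*} [NormedAddCommGroup E] {f : ℝ → E}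
    {K r R : ℝ} (hf : ContinuousOn f (Ioi 0)) (hr : 0 < r)
    (h0 : ∀ x, 0 < x → x ≤ r → ‖f x‖ ≤ K * x ^ (-(1 / 2) : ℝ)) (hR : IntegrableOn f (Ioi R)) :
    IntegrableOn f (Ioi 0) := by
  have h1 : IntegrableOn f (Ioc 0 r) := by
    have hp : IntegrableOn (fun x : ℝ => K * x ^ (-(1 / 2) : ℝ)) (Ioc 0 r) := by
      rw [integrableOn_Ioc_iff_integrableOn_Ioo]
      exact ((intervalIntegral.integrableOn_Ioo_rpow_iff hr).2 (by norm_num)).const_mul K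
    refine Integrable.mono' hp ((hf.mono fun x hx => hx.1).aestronglyMeasurable
      measurableSet_Ioc) ?_
    filter_upwards [ae_restrict_mem measurableSet_Ioc] with x hx using h0 x hx.1 hx.2
  have h2 : IntegrableOn f (Icc r (max r R)) :=
    (hf.mono fun x hx => hr.trans_le hx.1).integrableOn_compact isCompact_Icc
  refine ((h1.union h2).union hR).mono_set fun x hx => ?_
  have hx' : 0 < x := hx
  by_cases h : x ≤ r
  · exact Or.inl (Or.inl ⟨hx', h⟩)
  · by_cases h' : x ≤ R
    · exact Or.inl (Or.inr ⟨(not_le.1 h).le, h'.trans (le_max_right _ _)⟩)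
    · exact Or.inr (not_le.1 h')

theorem tendsto_intervalIntegral_exp_neg_exp {h : ℝ → ℂ} (hh : IntegrableOn h (Ioi 0)) :
    Tendsto (fun L : ℝ => ∫ u in (Real.exp (-L))..(Real.exp L), h u) atTop
      (𝓝 (∫ u in Ioi 0, h u)) := by
  have hc : AECover (volume.restrict (Ioi (0 : ℝ))) atTop
      (fun L : ℝ => Ioc (Real.exp (-L)) (Real.exp L)) := by
    refine ⟨?_, fun _ => measurableSet_Ioc⟩
    filter_upwards [ae_restrict_mem measurableSet_Ioi] with x hx
    have e1 : ∀ᶠ L : ℝ in atTop, Real.exp (-L) < x :=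
      (Real.tendsto_exp_neg_atTop_nhds_zero).eventually_lt_const hx
    filter_upwards [e1, Real.tendsto_exp_atTop.eventually_ge_atTop x] with L h1 h2 using ⟨h1, h2⟩
  have := hc.integral_tendsto_of_countably_generated hh
  refine this.congr' ?_
  filter_upwards [eventually_ge_atTop (0 : ℝ)] with L hL
  rw [intervalIntegral.integral_of_le (Real.exp_le_exp.2 (by linarith)),
    Measure.restrict_restrict measurableSet_Ioc, inter_eq_left.2]
  exact fun x hx => (Real.exp_pos _).trans hx.1

/-- The closed upper half-plane without the origin. -/
def closedUpper : Set ℂ := {w | 0 ≤ w.im ∧ w ≠ 0}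

theorem ofReal_mem_closedUpper {x : ℝ} (hx : x ≠ 0) : (x : ℂ) ∈ closedUpper :=
  ⟨by simp, by exact_mod_cast hx⟩

theorem exp_mem_closedUpper {ζ : ℂ} (h : ζ.im ∈ Icc 0 Real.pi) : Complex.exp ζ ∈ closedUpper :=
  ⟨by rw [Complex.exp_im]
      exact mul_nonneg (Real.exp_pos _).le (Real.sin_nonneg_of_nonneg_of_le_pi h.1 h.2),
    Complex.exp_ne_zero _⟩

theorem integrableOn_upper_boundary {k : ℂ → ℂ} (hc : ContinuousOn k closedUpper)
    {K r R : ℝ} (hr : 0 < r) (hR : 0 < R)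
    (h0 : ∀ w ∈ closedUpper, ‖w‖ ≤ r → ‖k w‖ ≤ K * ‖w‖ ^ (-(1 / 2) : ℝ))
    (hi : ∀ w ∈ closedUpper, R ≤ ‖w‖ → ‖k w‖ ≤ K * ‖w‖ ^ (-2 : ℝ)) :
    IntegrableOn (fun x : ℝ => k x) (Ioi 0) ∧ IntegrableOn (fun x : ℝ => k (-x)) (Ioi 0) := by
  have key : ∀ ε : ℝ, ‖ε‖ = 1 → IntegrableOn (fun x : ℝ => k ((ε * x : ℝ) : ℂ)) (Ioi 0) := by
    intro ε hε
    have hε0 : ε ≠ 0 := by rintro rfl; simp at hε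
    have hmem : ∀ x ∈ Ioi (0 : ℝ), ((ε * x : ℝ) : ℂ) ∈ closedUpper := fun x hx =>
      ofReal_mem_closedUpper (mul_ne_zero hε0 (ne_of_gt hx))
    have hn : ∀ x ∈ Ioi (0 : ℝ), ‖((ε * x : ℝ) : ℂ)‖ = x := fun x hx => by
      rw [Complex.norm_real, norm_mul, hε, one_mul, Real.norm_of_nonneg (le_of_lt hx)]
    have hcont : ContinuousOn (fun x : ℝ => k ((ε * x : ℝ) : ℂ)) (Ioi 0) :=
      hc.comp (by fun_prop) hmem
    refine integrableOn_Ioi_zero_of_bounds (K := K) (r := r) (R := R) hcont hr ?_ ?_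
    · intro x hx hxr
      have := h0 _ (hmem x hx) (by rwa [hn x hx])
      rwa [hn x hx] at this
    · refine Integrable.mono'
        ((integrableOn_Ioi_rpow_of_lt (a := -2) (by norm_num) hR).const_mul K)
        ((hcont.mono fun x hx => hR.trans hx).aestronglyMeasurable measurableSet_Ioi) ?_
      filter_upwards [ae_restrict_mem measurableSet_Ioi] with x hx
      have hx0 : x ∈ Ioi (0 : ℝ) := hR.trans hx
      have := hi _ (hmem x hx0) (by rw [hn x hx0]; exact le_of_lt hx)
      rwa [hn x hx0] at this
  have h1 := key 1 (by simp)
  have h2 := key (-1) (by simp)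
  simp only [one_mul, neg_mul, Complex.ofReal_neg] at h1 h2
  exact ⟨h1, h2⟩

theorem tendsto_vertical_integral {f : ℂ → ℂ} {B : ℝ → ℝ} (hB : Tendsto B atTop (𝓝 0))
    {c : ℝ → ℝ}
    (hf : ∀ᶠ L in atTop, ∀ y ∈ Icc 0 Real.pi, ‖f (c L + y * Complex.I)‖ ≤ B L) :
    Tendsto (fun L : ℝ => Complex.I • ∫ y in (0 : ℝ)..Real.pi, f (c L + y * Complex.I)) atTop
      (𝓝 0) := by
  suffices h : Tendsto (fun L : ℝ => ∫ y in (0 : ℝ)..Real.pi, f (c L + y * Complex.I)) atTop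
      (𝓝 0) by simpa using h.const_smul Complex.I
  refine squeeze_zero_norm' (a := fun L => B L * |Real.pi - 0|) ?_ (by simpa using hB.mul_const _)
  filter_upwards [hf] with L hL
  refine intervalIntegral.norm_integral_le_of_norm_le_const fun y hy => hL y ?_
  rw [uIoc_of_le Real.pi_pos.le] at hy
  exact ⟨hy.1.le, hy.2⟩

/-- Cauchy's theorem for the upper half-plane, for functions with controlled behaviour at
`0` and at infinity. -/
theorem integral_upper_boundary_eq_zero {k : ℂ → ℂ} (hc : ContinuousOn k closedUpper)
    (hd : ∀ w : ℂ, 0 < w.im → DifferentiableAt ℂ k w) {K r R : ℝ} (hr : 0 < r) (hR : 0 < R)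
    (h0 : ∀ w ∈ closedUpper, ‖w‖ ≤ r → ‖k w‖ ≤ K * ‖w‖ ^ (-(1 / 2) : ℝ))
    (hi : ∀ w ∈ closedUpper, R ≤ ‖w‖ → ‖k w‖ ≤ K * ‖w‖ ^ (-2 : ℝ)) :
    Integrable (fun x : ℝ => k x) ∧ ∫ x : ℝ, k x = 0 := by
  obtain ⟨hI1, hI2⟩ := integrableOn_upper_boundary hc hr hR h0 hi
  have hI2' : IntegrableOn (fun x : ℝ => k x) (Iic 0) := by
    have := (integrableOn_Ici_iff_integrableOn_Ioi).2 hI2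
    have h3 := (Measure.measurePreserving_neg (volume : Measure ℝ)).integrableOn_comp_preimage
      (MeasurableEquiv.neg ℝ).measurableEmbedding (f := fun x : ℝ => k x) (s := Iic 0)
    refine h3.1 ?_
    simpa [Function.comp_def] using this
  have hint : Integrable (fun x : ℝ => k x) := by
    rw [← integrableOn_univ, ← Iic_union_Ioi (a := (0 : ℝ))]
    exact hI2'.union hI1
  refine ⟨hint, ?_⟩
  have hsplit : ∫ x : ℝ, k x = (∫ x in Ioi (0 : ℝ), k x) + ∫ x in Ioi (0 : ℝ), k (-x) := by
    have := integral_comp_neg_Ioi 0 (fun x : ℝ => k x)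
    simp only [neg_zero, Complex.ofReal_neg] at this
    rw [this, add_comm, intervalIntegral.integral_Iic_add_Ioi hI2' hI1]
  rw [hsplit]
  -- The substitution `w = exp ζ` turns the upper half-annulus `exp (-L) ≤ ‖w‖ ≤ exp L` into a
  -- rectangle of height `π`. Its horizontal sides are the two real half-axes, its vertical sides
  -- the two semicircles.
  set f : ℂ → ℂ := fun ζ => Complex.exp ζ * k (Complex.exp ζ) with hfdef
  have hrect : ∀ L : ℝ, 0 < L →
      (((∫ x in (-L)..L, f (x + (0 : ℝ) * Complex.I)) -
        ∫ x in (-L)..L, f (x + Real.pi * Complex.I)) +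
        Complex.I • ∫ y in (0 : ℝ)..Real.pi, f (L + y * Complex.I)) -
        Complex.I • ∫ y in (0 : ℝ)..Real.pi, f ((-L : ℝ) + y * Complex.I) = 0 := by
    intro L hL
    have := Complex.integral_boundary_rect_eq_zero_of_continuousOn_of_differentiableOn f
      ⟨-L, 0⟩ ⟨L, Real.pi⟩ ?_ ?_
    · exact this
    · refine ContinuousOn.mul (by fun_prop) (hc.comp (by fun_prop) fun ζ hζ => ?_)
      have := hζ.2
      simp only [mem_preimage, uIcc_of_le Real.pi_pos.le] at this
      exact exp_mem_closedUpper this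
    · intro ζ hζ
      have h2 := hζ.2
      simp only [mem_preimage, min_eq_left Real.pi_pos.le, max_eq_right Real.pi_pos.le] at h2
      have him : 0 < (Complex.exp ζ).im := by
        rw [Complex.exp_im]
        exact mul_pos (Real.exp_pos _) (Real.sin_pos_of_pos_of_lt_pi h2.1 h2.2)
      have := (hd _ him).comp ζ Complex.differentiableAt_exp
      exact (Complex.differentiableAt_exp.mul this).differentiableWithinAt
  have hcv : ∀ h : ℝ → ℂ, ContinuousOn h (Ioi 0) → ∀ L : ℝ,
      ∫ x in (-L)..L, (Real.exp x : ℂ) * h (Real.exp x)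
        = ∫ u in (Real.exp (-L))..(Real.exp L), h u := by
    intro h hh L
    have := intervalIntegral.integral_deriv_smul_comp'' (a := -L) (b := L) (f := Real.exp)
      (f' := Real.exp) (g := h) (by fun_prop)
      (fun x _ => (Real.hasDerivAt_exp x).hasDerivWithinAt) (by fun_prop)
      (hh.mono (by rintro _ ⟨x, -, rfl⟩; exact Real.exp_pos x))
    simpa [Function.comp_def] using this
  have hA : ∀ L : ℝ, ∫ x in (-L)..L, f (x + (0 : ℝ) * Complex.I)
      = ∫ u in (Real.exp (-L))..(Real.exp L), k u := by
    intro L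
    rw [← hcv (fun u => k u) (hc.comp (by fun_prop)
      fun x hx => ofReal_mem_closedUpper (ne_of_gt hx)) L]
    simp [hfdef]
  have hB : ∀ L : ℝ, ∫ x in (-L)..L, f (x + Real.pi * Complex.I)
      = -∫ u in (Real.exp (-L))..(Real.exp L), k (-u) := by
    intro L
    rw [← hcv (fun u => k (-u)) (hc.comp (by fun_prop)
      fun x hx => by
        have := ofReal_mem_closedUpper (neg_ne_zero.2 (ne_of_gt (show (0:ℝ) < x from hx)))
        simpa using this) L, ← intervalIntegral.integral_neg]
    simp [hfdef, Complex.exp_add]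
  have hnorm : ∀ (c y : ℝ), ‖Complex.exp (c + y * Complex.I)‖ = Real.exp c := fun c y => by
    simp [Complex.norm_exp]
  have hmem : ∀ (c : ℝ), ∀ y ∈ Icc 0 Real.pi, Complex.exp (c + y * Complex.I) ∈ closedUpper :=
    fun c y hy => exp_mem_closedUpper (by simpa using hy)
  have hR1 : Tendsto (fun L : ℝ => Complex.I • ∫ y in (0 : ℝ)..Real.pi, f (L + y * Complex.I))
      atTop (𝓝 0) := by
    refine tendsto_vertical_integral (B := fun L => K * Real.exp (-L)) (c := fun L => L)
      (by simpa using Real.tendsto_exp_neg_atTop_nhds_zero.const_mul K) ?_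
    filter_upwards [Real.tendsto_exp_atTop.eventually_ge_atTop R] with L hL y hy
    have := hi _ (hmem L y hy) (by rwa [hnorm])
    rw [hfdef, norm_mul]
    rw [hnorm] at *
    calc _ ≤ Real.exp L * (K * Real.exp L ^ (-2 : ℝ)) := by gcongr
      _ = K * (Real.exp L * Real.exp (L * (-2))) := by rw [← Real.exp_mul]; ring
      _ = _ := by rw [← Real.exp_add]; ring_nf
  have hR2 : Tendsto (fun L : ℝ => Complex.I • ∫ y in (0 : ℝ)..Real.pi,
      f ((-L : ℝ) + y * Complex.I)) atTop (𝓝 0) := by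
    refine tendsto_vertical_integral (B := fun L => K * Real.exp (-(L / 2))) (c := fun L => -L)
      ?_ ?_
    · have : Tendsto (fun L : ℝ => L / 2) atTop atTop := tendsto_id.atTop_div_const (by norm_num)
      simpa using (Real.tendsto_exp_neg_atTop_nhds_zero.comp this).const_mul K
    filter_upwards [Real.tendsto_exp_neg_atTop_nhds_zero.eventually_le_const hr] with L hL y hy
    have := h0 _ (hmem (-L) y hy) (by rwa [hnorm])
    rw [hfdef, norm_mul]
    rw [hnorm] at *
    calc _ ≤ Real.exp (-L) * (K * Real.exp (-L) ^ (-(1 / 2) : ℝ)) := by gcongr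
      _ = K * (Real.exp (-L) * Real.exp (-L * (-(1 / 2)))) := by rw [← Real.exp_mul]; ring
      _ = _ := by rw [← Real.exp_add]; ring_nf
  have hlim := (((tendsto_intervalIntegral_exp_neg_exp hI1).add
    (tendsto_intervalIntegral_exp_neg_exp hI2)).add hR1).sub hR2
  rw [add_zero, sub_zero] at hlim
  refine tendsto_nhds_unique (hlim.congr' ?_) tendsto_const_nhds
  filter_upwards [eventually_gt_atTop (0 : ℝ)] with L hL
  have := hrect L hL
  rw [hA, hB, sub_neg_eq_add] at this
  exact this

/-! ### Regularity and growth of `G` -/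

theorem clog_ne_zero {u : ℂ} (h0 : u ≠ 0) (h1 : u ≠ 1) : Complex.log u ≠ 0 := fun h =>
  h1 (by rw [← Complex.exp_log h0, h, Complex.exp_zero])

theorem one_add_mem_slitPlane {w : ℂ} (hw : w ∈ Complex.slitPlane) :
    1 + w ∈ Complex.slitPlane := by
  rw [Complex.mem_slitPlane_iff] at *
  simp only [Complex.add_re, Complex.one_re, Complex.add_im, Complex.one_im, zero_add]
  exact hw.imp (fun h => by linarith) id

theorem differentiableAt_G {w : ℂ} (hw : w ∈ Complex.slitPlane) : DifferentiableAt ℂ G w := by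
  have h1 := one_add_mem_slitPlane hw
  have hl : Complex.log (1 + w) ≠ 0 := clog_ne_zero (Complex.slitPlane_ne_zero h1)
    (by simpa using Complex.slitPlane_ne_zero hw)
  have e1 : DifferentiableAt ℂ Complex.log w := Complex.differentiableAt_log hw
  have e2 : DifferentiableAt ℂ (fun w => Complex.log (1 + w)) w :=
    ((differentiableAt_const _).add differentiableAt_id).clog h1
  exact (((differentiableAt_const _).sub (e1.div e2 hl)).mul differentiableAt_id).mul e1

theorem continuousWithinAt_clog {w : ℂ} (hw : w ∈ closedUpper) :
    ContinuousWithinAt Complex.log {w | 0 ≤ w.im} w := by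
  by_cases h : w ∈ Complex.slitPlane
  · exact (continuousAt_clog h).continuousWithinAt
  · rw [Complex.mem_slitPlane_iff, not_or, not_lt, not_not] at h
    refine Complex.continuousWithinAt_log_of_re_neg_of_im_zero
      (lt_of_le_of_ne h.1 fun h0 => hw.2 ?_) h.2
    exact Complex.ext h0 h.2

/-- The defaults `log 0 = 0` and `0⁻¹ = 0` give the true limit here, because `|log ‖u‖| → ∞`. This
makes `G` continuous at the boundary point `-1`, where `log (1 + w)` blows up. -/
theorem continuousAt_inv_clog_zero : ContinuousAt (fun u : ℂ => (Complex.log u)⁻¹) 0 := by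
  rw [← continuousWithinAt_compl_self, ContinuousWithinAt]
  simp only [Complex.log_zero, inv_zero]
  refine tendsto_inv₀_cobounded.comp (tendsto_norm_atTop_iff_cobounded.1 ?_)
  have h1 : Tendsto (fun u : ℂ => |Real.log ‖u‖|) (𝓝[≠] 0) atTop := by
    refine tendsto_abs_atBot_atTop.comp (Real.tendsto_log_nhdsGT_zero.comp ?_)
    exact tendsto_norm_nhdsNE_zero
  refine tendsto_atTop_mono (fun u => ?_) h1
  rw [← Complex.log_re]
  exact Complex.abs_re_le_norm _

theorem continuousOn_G : ContinuousOn G closedUpper := by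
  intro w hw
  have h1 : ContinuousWithinAt Complex.log closedUpper w :=
    (continuousWithinAt_clog hw).mono fun x hx => hx.1
  have h2 : ContinuousWithinAt (fun w => (Complex.log (1 + w))⁻¹) closedUpper w := by
    have hadd : ContinuousWithinAt (fun w : ℂ => 1 + w) closedUpper w := by fun_prop
    by_cases h0 : 1 + w = 0
    · refine ContinuousAt.comp_continuousWithinAt (g := fun u : ℂ => (Complex.log u)⁻¹) ?_ hadd
      rw [h0]
      exact continuousAt_inv_clog_zero
    · refine ContinuousWithinAt.inv₀ ?_ (clog_ne_zero h0 (by simpa using hw.2))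
      refine (continuousWithinAt_clog (w := 1 + w) ⟨by simpa using hw.1, h0⟩).comp hadd ?_
      intro x hx
      simpa using hx.1
  exact ((continuousWithinAt_const.sub (h1.mul h2)).mul continuousWithinAt_id).mul h1

theorem norm_clog_le {w : ℂ} (hw : w ≠ 0) (h : ‖w‖ ≤ 1) :
    ‖Complex.log w‖ ≤ 8 * ‖w‖ ^ (-(1 / 4) : ℝ) := by
  have hpos : 0 < ‖w‖ := norm_pos_iff.2 hw
  have h1 : |Real.log ‖w‖| ≤ 4 * ‖w‖ ^ (-(1 / 4) : ℝ) := by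
    have := (Real.abs_log_mul_self_rpow_lt ‖w‖ (1 / 4) hpos h (by norm_num)).le
    rw [abs_mul, abs_of_pos (Real.rpow_pos_of_pos hpos _)] at this
    rw [Real.rpow_neg hpos.le, ← div_eq_mul_inv, le_div_iff₀ (Real.rpow_pos_of_pos hpos _)]
    linarith
  have h2 : 1 ≤ ‖w‖ ^ (-(1 / 4) : ℝ) :=
    Real.one_le_rpow_of_pos_of_le_one_of_nonpos hpos h (by norm_num)
  have h3 := Complex.norm_le_abs_re_add_abs_im (Complex.log w)
  rw [Complex.log_re, Complex.log_im] at h3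
  have h4 := Complex.abs_arg_le_pi w
  have h5 := Real.pi_lt_four
  linarith

/-- Near `0`, `w / log (1 + w)` is bounded by `2`, so only two logarithmic factors remain; each
costs `‖w‖ ^ (-1/4)`. The constant is `9 * 2 * 8 + 1`. -/
theorem norm_one_sub_G_le_of_norm_le {w : ℂ} (hw : w ≠ 0) (h : ‖w‖ ≤ 1 / 2) :
    ‖1 - G w‖ ≤ 145 * ‖w‖ ^ (-(1 / 2) : ℝ) := by
  have hpos : 0 < ‖w‖ := norm_pos_iff.2 hw
  set r := ‖w‖ ^ (-(1 / 4) : ℝ) with hr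
  have hr1 : 1 ≤ r := Real.one_le_rpow_of_pos_of_le_one_of_nonpos hpos (by linarith) (by norm_num)
  have hrr : ‖w‖ ^ (-(1 / 2) : ℝ) = r * r := by
    rw [hr, ← Real.rpow_add hpos]; norm_num
  have hl := norm_clog_le hw (by linarith)
  have h1 := Complex.norm_log_one_add_sub_self_le (z := w) (by linarith)
  have h2 := Complex.norm_log_one_add_half_le_self h
  have hinv : (1 - ‖w‖)⁻¹ ≤ 2 := by
    rw [inv_le_comm₀ (by linarith) (by norm_num)]; linarith
  have h3 : ‖w‖ / 2 ≤ ‖Complex.log (1 + w)‖ := by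
    have h4 : ‖w‖ ^ 2 * (1 - ‖w‖)⁻¹ / 2 ≤ ‖w‖ / 2 := by
      have : ‖w‖ ^ 2 * (1 - ‖w‖)⁻¹ ≤ ‖w‖ ^ 2 * 2 := by gcongr
      nlinarith
    have h5 := norm_sub_norm_le w (Complex.log (1 + w))
    rw [norm_sub_rev] at h5
    linarith
  have hl0 : Complex.log (1 + w) ≠ 0 := by
    intro h0; rw [h0, norm_zero] at h3; linarith
  have hG : G w = (Complex.log (1 + w) - Complex.log w) * (w / Complex.log (1 + w))
      * Complex.log w := by
    rw [G]; field_simp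
  have h6 : ‖w / Complex.log (1 + w)‖ ≤ 2 := by
    rw [norm_div, div_le_iff₀ (norm_pos_iff.2 hl0)]; linarith
  have h7 : ‖Complex.log (1 + w) - Complex.log w‖ ≤ 9 * r :=
    (norm_sub_le _ _).trans (by linarith)
  have h8 : ‖G w‖ ≤ 9 * r * 2 * (8 * r) := by
    rw [hG, norm_mul, norm_mul]; gcongr
  rw [hrr]
  have := norm_sub_le 1 (G w)
  rw [norm_one] at this
  nlinarith

/-- No multiple of `2πi` appears: `arg w` lies in `[0, π]` and `arg (1 + w⁻¹)` in `[-π/2, 0]`, so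
the sum stays in the principal range. -/
theorem clog_one_add_eq {w : ℂ} (hw : w ∈ closedUpper) (h : 1 < ‖w‖) :
    Complex.log (1 + w) = Complex.log w + Complex.log (1 + w⁻¹) := by
  have hn : ‖w⁻¹‖ < 1 := by rw [norm_inv]; exact inv_lt_one_of_one_lt₀ h
  have hre : 0 < (1 + w⁻¹).re := by
    have := (abs_lt.1 ((Complex.abs_re_le_norm w⁻¹).trans_lt hn)).1
    simp only [Complex.add_re, Complex.one_re]; linarith
  have hne : 1 + w⁻¹ ≠ 0 := fun h0 => by rw [h0] at hre; simp at hre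
  have him : (1 + w⁻¹).im ≤ 0 := by
    simp only [Complex.add_im, Complex.one_im, zero_add, Complex.inv_im]
    exact div_nonpos_of_nonpos_of_nonneg (by linarith [hw.1]) (Complex.normSq_nonneg _)
  have e : 1 + w = w * (1 + w⁻¹) := by have := hw.2; field_simp; ring
  have harg1 : 0 ≤ w.arg := Complex.arg_nonneg_iff.2 hw.1
  have harg2 := Complex.arg_le_pi w
  have harg3 : -(Real.pi / 2) ≤ (1 + w⁻¹).arg := Complex.neg_pi_div_two_le_arg_iff.2 (Or.inl hre.le)
  have harg4 : (1 + w⁻¹).arg ≤ 0 := by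
    rcases him.lt_or_eq with h | h
    · exact (Complex.arg_neg_iff.2 h).le
    · exact (Complex.arg_eq_zero_iff.2 ⟨hre.le, h⟩).le
  rw [e]
  exact Complex.log_mul hw.2 hne ⟨by linarith [Real.pi_pos], by linarith⟩

/-- With `δ = log (1 + w⁻¹)` one has `G w = w δ - w δ² / log (1 + w)`, and `w δ = 1 + O(1 / ‖w‖)`.
-/
theorem norm_one_sub_G_le_of_le_norm {w : ℂ} (hw : w ∈ closedUpper) (h : 4 ≤ ‖w‖) :
    ‖1 - G w‖ ≤ 4 / ‖w‖ := by
  have hpos : 0 < ‖w‖ := by linarith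
  have hlog := clog_one_add_eq hw (by linarith)
  have hn : ‖w⁻¹‖ ≤ 1 / 4 := by rw [norm_inv, inv_le_comm₀ hpos (by norm_num)]; linarith
  set δ := Complex.log (1 + w⁻¹) with hδ
  have h1 : ‖δ - w⁻¹‖ ≤ ‖w⁻¹‖ ^ 2 := by
    refine (Complex.norm_log_one_add_sub_self_le (by linarith)).trans ?_
    have : (1 - ‖w⁻¹‖)⁻¹ ≤ 2 := by
      rw [inv_le_comm₀ (by linarith) (by norm_num)]; linarith
    nlinarith [sq_nonneg ‖w⁻¹‖]
  have h2 : ‖δ‖ ≤ 3 / 2 * ‖w⁻¹‖ := Complex.norm_log_one_add_half_le_self (by linarith)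
  -- The threshold `4` enters here: `‖1 + w‖ ≥ 3 > e`.
  have h3 : 1 ≤ ‖Complex.log (1 + w)‖ := by
    refine le_trans ?_ ((le_abs_self _).trans (Complex.abs_re_le_norm _))
    rw [Complex.log_re, Real.le_log_iff_exp_le]
    · have := norm_sub_norm_le w (-1)
      rw [sub_neg_eq_add, norm_neg, norm_one, add_comm] at this
      linarith [Real.exp_one_lt_d9]
    · have := norm_sub_norm_le w (-1)
      rw [sub_neg_eq_add, norm_neg, norm_one, add_comm] at this
      linarith
  have hl0 : Complex.log (1 + w) ≠ 0 := by
    intro h0; rw [h0, norm_zero] at h3; linarith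
  have hG : 1 - G w = -(w * (δ - w⁻¹)) + w * δ * δ / Complex.log (1 + w) := by
    have hw0 := hw.2
    have hlw : Complex.log w = Complex.log (1 + w) - δ := by rw [hlog]; ring
    rw [G, hlw]
    generalize Complex.log (1 + w) = l at *
    field_simp
    ring
  have e1 : ‖w‖ * ‖w⁻¹‖ = 1 := by rw [norm_inv]; field_simp
  have h4 : ‖w * (δ - w⁻¹)‖ ≤ ‖w⁻¹‖ := by
    rw [norm_mul]
    calc _ ≤ ‖w‖ * ‖w⁻¹‖ ^ 2 := by gcongr
      _ = ‖w⁻¹‖ := by rw [sq, ← mul_assoc, e1, one_mul]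
  have h5 : ‖w * δ * δ / Complex.log (1 + w)‖ ≤ 3 * ‖w⁻¹‖ := by
    rw [norm_div, norm_mul, norm_mul]
    calc _ ≤ ‖w‖ * ‖δ‖ * ‖δ‖ := div_le_self (by positivity) h3
      _ ≤ ‖w‖ * (3 / 2 * ‖w⁻¹‖) * (3 / 2 * ‖w⁻¹‖) := by gcongr
      _ = 9 / 4 * (‖w‖ * ‖w⁻¹‖) * ‖w⁻¹‖ := by ring
      _ ≤ _ := by rw [e1]; linarith [norm_nonneg w⁻¹]
  rw [hG, div_eq_mul_inv 4, ← norm_inv]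
  refine (norm_add_le _ _).trans ?_
  rw [norm_neg]
  linarith

/-! ### The density `ρ` as a boundary value -/

theorem G_ofReal {x : ℝ} (hx : 0 < x) :
    G x = (((1 - Real.log x / Real.log (1 + x)) * x * Real.log x : ℝ) : ℂ) := by
  have h1 : Complex.log (1 + x) = (Real.log (1 + x) : ℂ) := by
    rw [Complex.ofReal_log (by linarith)]; simp
  rw [G, h1, ← Complex.ofReal_log hx.le]
  push_cast
  rfl

theorem clog_neg_ofReal {x : ℝ} (hx : 0 < x) :
    Complex.log (-x) = Real.log x + Real.pi * Complex.I := by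
  have := Complex.log_ofReal_mul hx (x := -1) (by norm_num)
  rwa [Complex.log_neg_one, mul_neg_one] at this

/-- On the negative axis the principal logarithm has argument `π`, so it takes its boundary value
from above. This identifies `rho` as the Stieltjes density. -/
theorem G_neg_im {t : ℝ} (ht : 0 < t) : (G (-t)).im = Real.pi * rho t := by
  have hl := clog_neg_ofReal ht
  rcases lt_trichotomy t 1 with h | h | h
  · have h1 : Complex.log (1 + -t) = (Real.log (1 - t) : ℂ) := by
      rw [Complex.ofReal_log (by linarith)]; congr 1; push_cast; ring
    have hm : Real.log ((1 - t) / t ^ 2) = Real.log (1 - t) - 2 * Real.log t := by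
      rw [Real.log_div (by linarith) (by positivity), Real.log_pow]; norm_num
    have hm0 : Real.log (1 - t) ≠ 0 := (Real.log_neg (by linarith) (by linarith)).ne
    rw [rho, if_pos h, hm, G, h1, hl]
    have e : (1 - ((Real.log t : ℂ) + Real.pi * Complex.I) / (Real.log (1 - t) : ℂ)) * -(t : ℂ)
        * (Real.log t + Real.pi * Complex.I)
        = ((-t * (Real.log t - (Real.log t ^ 2 - Real.pi ^ 2) / Real.log (1 - t)) : ℝ) : ℂ)
          + ((-t * Real.pi * (1 - 2 * Real.log t / Real.log (1 - t)) : ℝ) : ℂ) * Complex.I := by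
      have : (Real.log (1 - t) : ℂ) ≠ 0 := by exact_mod_cast hm0
      push_cast
      field_simp
      ring_nf
      rw [Complex.I_sq]
      ring
    rw [e, Complex.add_im, Complex.ofReal_im, Complex.im_ofReal_mul, Complex.I_im, zero_add]
    field_simp
  -- Here `log (1 + -1) = log 0 = 0`, so the quotient is `0` and `G (-1) = -πi`.
  · subst h
    simp [rho, G, Complex.log_neg_one]
  · have h1 : Complex.log (1 + -t) = Real.log (t - 1) + Real.pi * Complex.I := by
      rw [← clog_neg_ofReal (by linarith)]; congr 1; push_cast; ring
    have hm : Real.log ((t - 1) / t) = Real.log (t - 1) - Real.log t := by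
      rw [Real.log_div (by linarith) (by positivity)]
    have hD : Real.log (t - 1) ^ 2 + Real.pi ^ 2 ≠ 0 := by positivity
    rw [rho, if_neg (by linarith), if_neg (by linarith), hm, G, h1, hl]
    generalize Real.log (t - 1) = m at *
    generalize Real.log t = l at *
    have hne : (m : ℂ) + Real.pi * Complex.I ≠ 0 := fun h0 => by
      have := congrArg Complex.im h0
      simp at this
    have hDc : ((m : ℂ) ^ 2 + (Real.pi : ℂ) ^ 2) ≠ 0 := by exact_mod_cast hD
    have e : (1 - ((l : ℂ) + Real.pi * Complex.I) / (m + Real.pi * Complex.I)) * -(t : ℂ)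
        * (l + Real.pi * Complex.I)
        = ((-t * (m - l) * (l * m + Real.pi ^ 2) / (m ^ 2 + Real.pi ^ 2) : ℝ) : ℂ)
          + ((-t * Real.pi * (m - l) ^ 2 / (m ^ 2 + Real.pi ^ 2) : ℝ) : ℂ) * Complex.I := by
      push_cast
      field_simp
      ring_nf
      simp only [Complex.I_sq]
      ring
    rw [e, Complex.add_im, Complex.ofReal_im, Complex.im_ofReal_mul, Complex.I_im, zero_add]
    field_simp

/-- Continuity is inherited from the boundary values of `G`, which avoids matching the three
formulas at `t = 1`. -/
theorem continuousOn_rho : ContinuousOn rho (Ioi 0) := by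
  have h : ContinuousOn (fun t : ℝ => (G (-t)).im / Real.pi) (Ioi 0) := by
    refine (Complex.continuous_im.comp_continuousOn
      (continuousOn_G.comp (by fun_prop) fun t ht => ?_)).div_const _
    exact ⟨by simp, by simpa using ne_of_gt (show (0 : ℝ) < t from ht)⟩
  refine h.congr fun t ht => ?_
  change rho t = (G (-t)).im / Real.pi
  rw [eq_div_iff Real.pi_ne_zero, G_neg_im ht, mul_comm]

theorem integrableOn_inv_mul_log_sq :
    IntegrableOn (fun t : ℝ => (t - 1)⁻¹ / Real.log (t - 1) ^ 2) (Ioi 4) := by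
  refine integrableOn_Ioi_deriv_of_nonneg' (g := fun t => -(Real.log (t - 1))⁻¹) (l := 0) ?_ ?_ ?_
  · intro x hx
    have hx4 : (4 : ℝ) ≤ x := hx
    have hl : Real.log (x - 1) ≠ 0 := (Real.log_pos (by linarith)).ne'
    have h1 : HasDerivAt (fun t : ℝ => t - 1) 1 x := (hasDerivAt_id' x).sub_const 1
    exact (((h1.log (by linarith)).inv hl).neg).congr_deriv (by rw [neg_div, neg_neg, one_div])
  · intro x hx
    have hx4 : (4 : ℝ) < x := hx
    exact div_nonneg (inv_nonneg.2 (by linarith)) (sq_nonneg _)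
  · have : Tendsto (fun t : ℝ => Real.log (t - 1)) atTop atTop :=
      Real.tendsto_log_atTop.comp (tendsto_atTop_add_const_right _ (-1) tendsto_id)
    simpa using this.inv_tendsto_atTop.neg

theorem integrableOn_rho : IntegrableOn rho (Ioi 0) := by
  refine integrableOn_Ioi_zero_of_bounds (K := 145) (r := 1 / 2) (R := 4) continuousOn_rho
    (by norm_num) ?_ ?_
  · intro t ht htr
    have h1 := norm_one_sub_G_le_of_norm_le (w := -t) (by simpa using ht.ne')
      (by simpa [abs_of_pos ht] using htr)
    have h2 := Complex.abs_im_le_norm (1 - G (-t))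
    rw [norm_neg, Complex.norm_real, Real.norm_of_nonneg ht.le] at h1
    rw [Complex.sub_im, Complex.one_im, zero_sub, abs_neg, G_neg_im ht, abs_mul,
      abs_of_pos Real.pi_pos] at h2
    rw [Real.norm_eq_abs]
    nlinarith [Real.pi_gt_three, abs_nonneg (rho t)]
  -- The bound `4 / ‖w‖` on `1 - G` is not integrable at infinity; the explicit formula gains the
  -- factor `1 / log²` needed for convergence.
  · refine Integrable.mono' (integrableOn_inv_mul_log_sq.const_mul 2)
      ((continuousOn_rho.mono fun x hx => (by norm_num : (0 : ℝ) < 4).trans hx).aestronglyMeasurable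
        measurableSet_Ioi) ?_
    filter_upwards [ae_restrict_mem measurableSet_Ioi] with t ht
    have ht4 : (4 : ℝ) < t := ht
    have hm : 0 < Real.log (t - 1) := Real.log_pos (by linarith)
    have h1 : Real.log ((t - 1) / t) ^ 2 ≤ (t - 1)⁻¹ ^ 2 := by
      rw [sq_le_sq, abs_of_pos (inv_pos.2 (by linarith : (0 : ℝ) < t - 1)), abs_le]
      constructor
      · have := Real.one_sub_inv_le_log_of_pos (x := (t - 1) / t)
          (div_pos (by linarith) (by linarith))
        refine le_trans (le_of_eq ?_) this
        have : t - 1 ≠ 0 := by linarith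
        field_simp
        ring
      · refine (Real.log_nonpos (div_nonneg (by linarith) (by linarith)) ?_).trans
          (inv_nonneg.2 (by linarith))
        rw [div_le_one (by linarith)]; linarith
    have h2 : t * (t - 1)⁻¹ ≤ 2 := by
      rw [← div_eq_mul_inv, div_le_iff₀ (by linarith)]; linarith
    rw [rho, if_neg (by linarith), if_neg (by linarith), norm_neg, Real.norm_of_nonneg
      (by positivity)]
    have h0 : 0 < (t - 1)⁻¹ := inv_pos.2 (by linarith)
    calc t * Real.log ((t - 1) / t) ^ 2 / (Real.log (t - 1) ^ 2 + Real.pi ^ 2)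
        ≤ t * (t - 1)⁻¹ ^ 2 / Real.log (t - 1) ^ 2 := by
          gcongr
          linarith [sq_nonneg Real.pi]
      _ = (t * (t - 1)⁻¹) * ((t - 1)⁻¹ / Real.log (t - 1) ^ 2) := by ring
      _ ≤ 2 * ((t - 1)⁻¹ / Real.log (t - 1) ^ 2) := by gcongr

/-! ### The Stieltjes representation of `1 - G` -/

theorem integral_poisson (a : ℝ) {y : ℝ} (hy : 0 < y) :
    Integrable (fun x : ℝ => ((x - a) ^ 2 + y ^ 2)⁻¹) ∧
      ∫ x : ℝ, ((x - a) ^ 2 + y ^ 2)⁻¹ = Real.pi / y := by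
  have e : (fun x : ℝ => ((x - a) ^ 2 + y ^ 2)⁻¹)
      = fun x => (y ^ 2)⁻¹ * (1 + ((x - a) / y) ^ 2)⁻¹ := by
    ext x; rw [← mul_inv]; congr 1; field_simp; ring
  have hi : Integrable (fun x : ℝ => (1 + (x / y) ^ 2)⁻¹) :=
    integrable_inv_one_add_sq.comp_div hy.ne'
  rw [e]
  refine ⟨(hi.comp_sub_right a).const_mul _, ?_⟩
  rw [integral_const_mul, integral_sub_right_eq_self (fun x : ℝ => (1 + (x / y) ^ 2)⁻¹) a,
    Measure.integral_comp_div (fun x : ℝ => (1 + x ^ 2)⁻¹) y, integral_univ_inv_one_add_sq,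
    abs_of_pos hy, smul_eq_mul]
  field_simp

theorem inv_norm_sub_le_of_norm_le {w c : ℂ} (hc : c ≠ 0) (h : ‖w‖ ≤ ‖c‖ / 2) :
    ‖w - c‖⁻¹ ≤ 2 / ‖c‖ := by
  have hc' : 0 < ‖c‖ := norm_pos_iff.2 hc
  have := norm_sub_norm_le c w
  rw [norm_sub_rev] at this
  rw [← inv_div]
  exact inv_anti₀ (by positivity) (by linarith)

theorem inv_norm_sub_le_of_le_norm {w c : ℂ} (hc : c ≠ 0) (h : 2 * ‖c‖ ≤ ‖w‖) :
    ‖w - c‖⁻¹ ≤ 2 / ‖w‖ := by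
  have hc' : 0 < ‖c‖ := norm_pos_iff.2 hc
  have := norm_sub_norm_le w c
  rw [← inv_div]
  exact inv_anti₀ (by linarith) (by linarith)

/-- The pole `conj z` lies in the lower half-plane, and dividing by `w - conj z` improves the decay
from `‖w‖⁻¹` to `‖w‖⁻²`. -/
theorem integral_one_sub_G_div_sub_conj {z : ℂ} (hz : 0 < z.im) :
    Integrable (fun x : ℝ => (1 - G x) / (x - starRingEnd ℂ z)) ∧
      ∫ x : ℝ, (1 - G x) / (x - starRingEnd ℂ z) = 0 := by
  set c := starRingEnd ℂ z with hcdef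
  have hcim : c.im < 0 := by simpa [hcdef] using hz
  have hc0 : c ≠ 0 := by rintro h; rw [h] at hcim; simp at hcim
  have hc' : 0 < ‖c‖ := norm_pos_iff.2 hc0
  have hne : ∀ w : ℂ, 0 ≤ w.im → w - c ≠ 0 := fun w hw h => by
    rw [sub_eq_zero.1 h] at hw; linarith
  refine integral_upper_boundary_eq_zero (k := fun w => (1 - G w) / (w - c))
    (K := 290 / ‖c‖ + 8) (r := min (1 / 2) (‖c‖ / 2)) (R := max 4 (2 * ‖c‖)) ?_ ?_
    (by positivity) (by positivity) ?_ ?_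
  · exact (continuousOn_const.sub continuousOn_G).div (by fun_prop) fun w hw => hne w hw.1
  · intro w hw
    exact ((differentiableAt_const _).sub (differentiableAt_G (Or.inr hw.ne'))).div
      (by fun_prop) (hne w hw.le)
  · intro w hw hr
    have h1 := norm_one_sub_G_le_of_norm_le hw.2 (hr.trans (min_le_left _ _))
    have h2 := inv_norm_sub_le_of_norm_le hc0 (hr.trans (min_le_right _ _))
    rw [norm_div, div_eq_mul_inv]
    calc _ ≤ (145 * ‖w‖ ^ (-(1 / 2) : ℝ)) * (2 / ‖c‖) := by gcongr
      _ = 290 / ‖c‖ * ‖w‖ ^ (-(1 / 2) : ℝ) := by ring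
      _ ≤ _ := by gcongr; linarith
  · intro w hw hr
    have h1 := norm_one_sub_G_le_of_le_norm hw ((le_max_left _ _).trans hr)
    have h2 := inv_norm_sub_le_of_le_norm hc0 ((le_max_right _ _).trans hr)
    rw [norm_div, div_eq_mul_inv, Real.rpow_neg (norm_nonneg _)]
    norm_num only [Real.rpow_ofNat]
    calc _ ≤ (4 / ‖w‖) * (2 / ‖w‖) := by gcongr
      _ = 8 * (‖w‖ ^ 2)⁻¹ := by field_simp; norm_num
      _ ≤ _ := by
        gcongr
        have : 0 ≤ 290 / ‖c‖ := by positivity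
        linarith

/-- The divided difference has a removable singularity at `z`, so Cauchy's theorem applies with no
residue. The value `1 - G z` that it subtracts is recovered later from the Poisson integral. -/
theorem integral_dslope_one_sub_G {z : ℂ} (hz : 0 < z.im) :
    Integrable (fun x : ℝ => dslope (fun w => 1 - G w) z x / (x - starRingEnd ℂ z)) ∧
      ∫ x : ℝ, dslope (fun w => 1 - G w) z x / (x - starRingEnd ℂ z) = 0 := by
  set c := starRingEnd ℂ z with hcdef
  set f : ℂ → ℂ := fun w => 1 - G w with hf
  have hcim : c.im < 0 := by simpa [hcdef] using hz
  have hc0 : c ≠ 0 := by rintro h; rw [h] at hcim; simp at hcim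
  have hz0 : z ≠ 0 := by rintro h; rw [h] at hz; simp at hz
  have hcz : ‖c‖ = ‖z‖ := by simp [hcdef]
  have hz' : 0 < ‖z‖ := norm_pos_iff.2 hz0
  have hne : ∀ w : ℂ, 0 ≤ w.im → w - c ≠ 0 := fun w hw h => by
    rw [sub_eq_zero.1 h] at hw; linarith
  have hopen : IsOpen {w : ℂ | 0 < w.im} := isOpen_lt continuous_const Complex.continuous_im
  have hfd : DifferentiableOn ℂ f {w : ℂ | 0 < w.im} := fun w hw =>
    ((differentiableAt_const _).sub
      (differentiableAt_G (Or.inr (ne_of_gt hw)))).differentiableWithinAt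
  have hds : DifferentiableOn ℂ (dslope f z) {w : ℂ | 0 < w.im} :=
    (Complex.differentiableOn_dslope (hopen.mem_nhds hz)).2 hfd
  have hdn : ∀ w, w ≠ z → ‖dslope f z w / (w - c)‖ = ‖f w - f z‖ * ‖w - z‖⁻¹ * ‖w - c‖⁻¹ := by
    intro w hw
    rw [dslope_of_ne _ hw, slope_def_field, norm_div, norm_div, div_eq_mul_inv, div_eq_mul_inv]
  refine integral_upper_boundary_eq_zero (k := fun w => dslope f z w / (w - c))
    (K := (145 + ‖f z‖) * (2 / ‖z‖) ^ 2 + (1 + ‖f z‖) * 4)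
    (r := min (1 / 2) (‖z‖ / 2)) (R := max 4 (2 * ‖z‖)) ?_ ?_
    (by positivity) (by positivity) ?_ ?_
  · refine ContinuousOn.div (fun w hw => ?_) (by fun_prop) fun w hw => hne w hw.1
    by_cases hwz : w = z
    · have : DifferentiableAt ℂ (dslope f z) w :=
        hds.differentiableAt (hopen.mem_nhds (by rw [hwz]; exact hz))
      exact this.continuousAt.continuousWithinAt
    · exact (continuousWithinAt_dslope_of_ne hwz).2 (continuousOn_const.sub continuousOn_G w hw)
  · intro w hw
    exact (hds.differentiableAt (hopen.mem_nhds hw)).div (by fun_prop) (hne w hw.le)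
  · intro w hw hr
    have hr1 := hr.trans (min_le_left _ _)
    have hr2 := hr.trans (min_le_right _ _)
    have hwz : w ≠ z := by rintro rfl; linarith
    have h1 : ‖f w‖ ≤ _ := norm_one_sub_G_le_of_norm_le hw.2 hr1
    have h2 := inv_norm_sub_le_of_norm_le hz0 hr2
    have h3 := inv_norm_sub_le_of_norm_le (w := w) hc0 (by rwa [hcz])
    rw [hcz] at h3
    have h4 : 1 ≤ ‖w‖ ^ (-(1 / 2) : ℝ) := Real.one_le_rpow_of_pos_of_le_one_of_nonpos
      (norm_pos_iff.2 hw.2) (by linarith) (by norm_num)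
    have h5 : ‖f w - f z‖ ≤ (145 + ‖f z‖) * ‖w‖ ^ (-(1 / 2) : ℝ) := by
      refine (norm_sub_le _ _).trans ?_
      nlinarith [norm_nonneg (f z)]
    rw [hdn w hwz]
    calc _ ≤ ((145 + ‖f z‖) * ‖w‖ ^ (-(1 / 2) : ℝ)) * (2 / ‖z‖) * (2 / ‖z‖) := by gcongr
      _ = (145 + ‖f z‖) * (2 / ‖z‖) ^ 2 * ‖w‖ ^ (-(1 / 2) : ℝ) := by ring
      _ ≤ _ := by gcongr; linarith [norm_nonneg (f z)]
  · intro w hw hr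
    have hr1 := (le_max_left _ _).trans hr
    have hr2 := (le_max_right _ _).trans hr
    have hwz : w ≠ z := by rintro rfl; linarith
    have h1 : ‖f w‖ ≤ _ := norm_one_sub_G_le_of_le_norm hw hr1
    have h2 := inv_norm_sub_le_of_le_norm hz0 hr2
    have h3 := inv_norm_sub_le_of_le_norm (w := w) hc0 (by rwa [hcz])
    have hw0 : 0 < ‖w‖ := by linarith
    have h4 : 4 / ‖w‖ ≤ 1 := by rwa [div_le_one hw0]
    have h5 : ‖f w - f z‖ ≤ 1 + ‖f z‖ := (norm_sub_le _ _).trans (by linarith)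
    rw [hdn w hwz, Real.rpow_neg (norm_nonneg _)]
    norm_num only [Real.rpow_ofNat]
    calc _ ≤ (1 + ‖f z‖) * (2 / ‖w‖) * (2 / ‖w‖) := by gcongr
      _ = (1 + ‖f z‖) * 4 * (‖w‖ ^ 2)⁻¹ := by field_simp; norm_num
      _ ≤ _ := by
        gcongr
        have : 0 ≤ (145 + ‖f z‖) * (2 / ‖z‖) ^ 2 := by positivity
        linarith

theorem one_sub_G_eq_integral_of_im_pos {z : ℂ} (hz : 0 < z.im) :
    1 - G z = ∫ t in Ioi (0 : ℝ), (rho t : ℂ) / (t + z) := by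
  obtain ⟨i1, e1⟩ := integral_one_sub_G_div_sub_conj hz
  obtain ⟨i2, e2⟩ := integral_dslope_one_sub_G hz
  obtain ⟨i3, e3⟩ := integral_poisson z.re hz
  set k1 : ℝ → ℂ := fun x => (1 - G x) / (x - starRingEnd ℂ z)
  set k2 : ℝ → ℂ := fun x => dslope (fun w => 1 - G w) z x / (x - starRingEnd ℂ z)
  set p : ℝ → ℝ := fun x => ((x - z.re) ^ 2 + z.im ^ 2)⁻¹
  have hne : ∀ x : ℝ, (x : ℂ) - z ≠ 0 := fun x h => by
    have := congrArg Complex.im h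
    simp at this
    linarith
  have hne' : ∀ x : ℝ, (x : ℂ) - starRingEnd ℂ z ≠ 0 := fun x h => by
    have := congrArg Complex.im h
    simp at this
    linarith
  -- The left side is `(1 - G x) / (x - z)` minus the conjugate of `k1 x`. The former is split by
  -- `1/(x - z) = 1/(x - conj z) + (z - conj z) p x`, then `1 - G x` in the second term is expanded
  -- around `1 - G z`. Only the Poisson term has a nonzero integral.
  have hpt : ∀ x : ℝ, (-(2 * Complex.I) * (G x).im) / (x - z)
      = k1 x + (z - starRingEnd ℂ z) * k2 x + (z - starRingEnd ℂ z) * (1 - G z) * (p x : ℂ)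
        - starRingEnd ℂ (k1 x) := by
    intro x
    have hp : (p x : ℂ) = ((x - z) * (x - starRingEnd ℂ z))⁻¹ := by
      have : (x - z) * (x - starRingEnd ℂ z) = (((x - z.re) ^ 2 + z.im ^ 2 : ℝ) : ℂ) := by
        have h : (x : ℂ) - starRingEnd ℂ z = starRingEnd ℂ (x - z) := by simp
        rw [h, Complex.mul_conj, Complex.normSq_apply]
        simp only [Complex.sub_re, Complex.ofReal_re, Complex.sub_im, Complex.ofReal_im]
        congr 1
        ring
      rw [this, ← Complex.ofReal_inv]
    have hk2 : k2 x = ((1 - G x) - (1 - G z)) / (x - z) / (x - starRingEnd ℂ z) := by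
      simp only [k2]
      rw [dslope_of_ne _ (sub_ne_zero.1 (hne x)), slope_def_field]
    have hk1 : starRingEnd ℂ (k1 x) = (1 - starRingEnd ℂ (G x)) / (x - z) := by
      simp [k1]
    have him : -(2 * Complex.I) * (G x).im = starRingEnd ℂ (G x) - G x := by
      apply Complex.ext <;> simp; ring
    rw [hp, hk2, hk1, him]
    have h1 := hne x
    have h2 := hne' x
    simp only [k1]
    field_simp
    ring
  have hint : ∫ x : ℝ, (-(2 * Complex.I) * (G x).im) / (x - z)
      = 2 * Real.pi * Complex.I * (1 - G z) := by
    simp only [hpt]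
    have i1' : Integrable (fun x => starRingEnd ℂ (k1 x)) :=
      (Complex.conjLIE.integrable_comp_iff).2 i1
    have i2' := i2.const_mul (z - starRingEnd ℂ z)
    have i3' : Integrable (fun x => (z - starRingEnd ℂ z) * (1 - G z) * (p x : ℂ)) :=
      (i3.ofReal (𝕜 := ℂ)).const_mul _
    have i12 : Integrable (fun x => k1 x + (z - starRingEnd ℂ z) * k2 x) := i1.add i2'
    have i123 : Integrable (fun x => k1 x + (z - starRingEnd ℂ z) * k2 x
        + (z - starRingEnd ℂ z) * (1 - G z) * (p x : ℂ)) := i12.add i3'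
    rw [integral_sub i123 i1', integral_add i12 i3', integral_add i1 i2', integral_const_mul, integral_const_mul, integral_conj,
      integral_complex_ofReal, e1, e2, e3]
    have hzim : (z.im : ℂ) ≠ 0 := by exact_mod_cast hz.ne'
    rw [Complex.sub_conj]
    push_cast
    field_simp
    simp
  -- `G` is real on the positive axis, so only the cut contributes.
  have hIic : ∫ x : ℝ, (-(2 * Complex.I) * (G x).im) / (x - z)
      = ∫ x in Iic (0 : ℝ), (-(2 * Complex.I) * (G x).im) / (x - z) := by
    refine (setIntegral_eq_integral_of_forall_compl_eq_zero fun x hx => ?_).symm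
    rw [mem_Iic, not_le] at hx
    rw [G_ofReal hx, Complex.ofReal_im]
    simp
  have hneg := integral_comp_neg_Ioi 0
    (fun x : ℝ => (-(2 * Complex.I) * (G x).im) / ((x : ℂ) - z))
  rw [neg_zero, ← hIic, hint] at hneg
  have hc : (2 * Real.pi * Complex.I : ℂ) ≠ 0 := Complex.two_pi_I_ne_zero
  refine mul_left_cancel₀ hc ?_
  rw [← hneg, ← integral_const_mul]
  refine setIntegral_congr_fun measurableSet_Ioi fun t ht => ?_
  have : (t : ℂ) + z ≠ 0 := fun h => hne (-t) (by push_cast; linear_combination -h)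
  simp only [Complex.ofReal_neg]
  rw [G_neg_im ht, show -(t : ℂ) - z = -(t + z) by ring]
  push_cast
  field_simp

/-! ### The Laplace transform `φ` -/

theorem integrableOn_exp_mul_rho {s : ℝ} (hs : 0 ≤ s) :
    IntegrableOn (fun t : ℝ => Real.exp (-s * t) * rho t) (Ioi 0) := by
  refine Integrable.mono integrableOn_rho
    ((by fun_prop : Continuous fun t : ℝ => Real.exp (-s * t)).aestronglyMeasurable.mul
      integrableOn_rho.aestronglyMeasurable) ?_
  filter_upwards [ae_restrict_mem measurableSet_Ioi] with t ht
  rw [norm_mul, Real.norm_of_nonneg (Real.exp_pos _).le]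
  refine mul_le_of_le_one_left (norm_nonneg _) (Real.exp_le_one_iff.2 ?_)
  have : 0 ≤ s * t := mul_nonneg hs (le_of_lt ht)
  linarith

/-- Fubini is justified by the product majorant `‖exp (-z s)‖ * |rho t|`, since `exp (-s t) ≤ 1`. -/
theorem integral_exp_mul_phi {z : ℂ} (hz : 0 < z.re) :
    IntegrableOn (fun s : ℝ => Complex.exp (-z * s) * (phi s : ℂ)) (Ioi 0) ∧
      ∫ s in Ioi (0 : ℝ), Complex.exp (-z * s) * (phi s : ℂ)
        = ∫ t in Ioi (0 : ℝ), (rho t : ℂ) / (t + z) := by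
  set μ := volume.restrict (Ioi (0 : ℝ)) with hμ
  have hexp : Integrable (fun s : ℝ => Complex.exp (-z * s)) μ :=
    integrableOn_exp_mul_complex_Ioi (by simpa using hz) 0
  have hρ : Integrable (fun t : ℝ => (rho t : ℂ)) μ := integrableOn_rho.ofReal
  have hF : Integrable (Function.uncurry fun s t : ℝ =>
      Complex.exp (-z * s) * (Complex.exp (-s * t) * (rho t : ℂ))) (μ.prod μ) := by
    refine Integrable.mono (hexp.mul_prod hρ) ?_ ?_
    · refine AEStronglyMeasurable.mul (Continuous.aestronglyMeasurable (by fun_prop))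
        (AEStronglyMeasurable.mul (Continuous.aestronglyMeasurable (by fun_prop)) ?_)
      exact hρ.aestronglyMeasurable.comp_snd
    · rw [hμ, Measure.prod_restrict]
      filter_upwards [ae_restrict_mem (measurableSet_Ioi.prod measurableSet_Ioi)] with p hp
      simp only [Function.uncurry, norm_mul]
      refine mul_le_mul_of_nonneg_left (mul_le_of_le_one_left (norm_nonneg _) ?_) (norm_nonneg _)
      have h : 0 ≤ p.1 * p.2 := mul_nonneg (le_of_lt hp.1) (le_of_lt hp.2)
      rw [Complex.norm_exp]
      simpa using h
  have hphi : ∀ s : ℝ, ∫ t, Complex.exp (-z * s) * (Complex.exp (-s * t) * (rho t : ℂ)) ∂μ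
      = Complex.exp (-z * s) * (phi s : ℂ) := by
    intro s
    rw [integral_const_mul, phi, ← integral_complex_ofReal]
    push_cast
    rfl
  constructor
  · have := hF.integral_prod_left
    simp only [Function.uncurry, hphi] at this
    exact this
  · simp only [← hphi]
    rw [integral_integral_swap hF]
    refine setIntegral_congr_fun measurableSet_Ioi fun t ht => ?_
    have ht' : (0 : ℝ) < t := ht
    have hre : (-(t + z)).re < 0 := by simp; linarith
    have h := integral_exp_mul_complex_Ioi hre 0
    have e : ∀ s : ℝ, Complex.exp (-z * s) * (Complex.exp (-s * t) * (rho t : ℂ))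
        = Complex.exp (-(t + z) * s) * (rho t : ℂ) := by
      intro s; rw [← mul_assoc, ← Complex.exp_add]; ring_nf
    simp only [e]
    rw [integral_mul_const, h]
    have : (t : ℂ) + z ≠ 0 := fun h0 => by rw [h0] at hre; simp at hre
    rw [Complex.ofReal_zero, mul_zero, Complex.exp_zero, neg_div_neg_eq, one_div_mul_eq_div]

theorem G_conj {z : ℂ} (hz : z ∈ Complex.slitPlane) :
    G (starRingEnd ℂ z) = starRingEnd ℂ (G z) := by
  have h1 := Complex.log_conj z (Complex.mem_slitPlane_iff_arg.1 hz).1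
  have h2 := Complex.log_conj _ (Complex.mem_slitPlane_iff_arg.1 (one_add_mem_slitPlane hz)).1
  rw [map_add, map_one] at h2
  simp [G, h1, h2]

theorem one_sub_G_eq_integral_of_im_ne {z : ℂ} (hz : 0 < z.re) (him : z.im ≠ 0) :
    1 - G z = ∫ s in Ioi (0 : ℝ), Complex.exp (-z * s) * (phi s : ℂ) := by
  rcases him.lt_or_gt with h | h
  · have h1 := one_sub_G_eq_integral_of_im_pos (z := starRingEnd ℂ z) (by simpa using h)
    rw [← (integral_exp_mul_phi (by simpa using hz)).2, G_conj (Or.inl hz)] at h1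
    have h2 := congrArg (starRingEnd ℂ) h1
    rw [← integral_conj] at h2
    simpa [← Complex.exp_conj] using h2
  · rw [one_sub_G_eq_integral_of_im_pos h, (integral_exp_mul_phi hz).2]

theorem ofReal_add_mul_I_mem_slitPlane {a : ℝ} (ha : 0 < a) (t : ℝ) :
    (a + t * Complex.I : ℂ) ∈ Complex.slitPlane := Or.inl (by simpa using ha)

theorem continuous_G_vertical {a : ℝ} (ha : 0 < a) :
    Continuous fun t : ℝ => G (a + t * Complex.I) := by
  refine continuous_iff_continuousAt.2 fun t => ?_
  exact (differentiableAt_G (ofReal_add_mul_I_mem_slitPlane ha t)).continuousAt.comp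
    (f := fun t : ℝ => (a + t * Complex.I : ℂ)) (by fun_prop)

theorem integrableOn_exp_mul_phi {a : ℝ} (ha : 0 < a) :
    IntegrableOn (fun s : ℝ => Real.exp (-a * s) * phi s) (Ioi 0) := by
  have h := (integral_exp_mul_phi (z := a) (by simpa using ha)).1.re
  refine h.congr (ae_of_all _ fun s => ?_)
  have : Complex.exp (-a * s) * (phi s : ℂ) = ((Real.exp (-a * s) * phi s : ℝ) : ℂ) := by
    push_cast; rfl
  change (Complex.exp (-a * s) * (phi s : ℂ)).re = _
  rw [this, Complex.ofReal_re]

theorem one_sub_G_eq_integral {a : ℝ} (ha : 0 < a) (t : ℝ) :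
    1 - G (a + t * Complex.I) = ∫ s in Ioi (0 : ℝ), Complex.exp (-(Complex.I * t * s)) *
      (Real.exp (-a * s) * phi s : ℝ) := by
  have hint := integrableOn_exp_mul_phi ha
  have hcont : Continuous fun t : ℝ => ∫ s in Ioi (0 : ℝ), Complex.exp (-(Complex.I * t * s)) *
      (Real.exp (-a * s) * phi s : ℝ) := by
    refine continuous_of_dominated (bound := fun s => ‖Real.exp (-a * s) * phi s‖) ?_ ?_
      hint.norm ?_
    · intro t
      exact (Continuous.aestronglyMeasurable (by fun_prop)).mul
        hint.ofReal.aestronglyMeasurable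
    · intro t
      refine ae_of_all _ fun s => ?_
      rw [norm_mul, Complex.norm_exp, Complex.norm_real]
      simp
    · exact ae_of_all _ fun s => by fun_prop
  -- Both sides are continuous in `t` and agree for `t ≠ 0`, which recovers the real point `t = 0`.
  refine congrFun (Continuous.ext_on (dense_compl_singleton (0 : ℝ))
    (continuous_const.sub (continuous_G_vertical ha)) hcont fun t ht => ?_) t
  have ht0 : t ≠ 0 := ht
  rw [Pi.sub_apply]
  rw [one_sub_G_eq_integral_of_im_ne (by simpa using ha) (by simpa using ht0)]
  refine setIntegral_congr_fun measurableSet_Ioi fun s _ => ?_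
  rw [Complex.ofReal_mul, Complex.ofReal_exp, ← mul_assoc, ← Complex.exp_add]
  push_cast
  ring_nf

theorem one_sub_G_ofReal_eq_integral {a : ℝ} (ha : 0 < a) :
    1 - G a = ((∫ t in Ioi (0 : ℝ), rho t / (t + a) : ℝ) : ℂ) := by
  have h := one_sub_G_eq_integral ha 0
  rw [Complex.ofReal_zero, zero_mul, add_zero] at h
  rw [h, ← integral_complex_ofReal]
  have h2 := (integral_exp_mul_phi (z := a) (by simpa using ha)).2
  push_cast
  rw [← h2]
  simp

/-! ### Signs of `G`, `ρ` and `φ` -/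

theorem log_div_log_one_add_mem_Icc {a : ℝ} (ha : 1 ≤ a) :
    Real.log a / Real.log (1 + a) ∈ Icc 0 1 := by
  have hl : 0 ≤ Real.log a := Real.log_nonneg ha
  have hl1 : 0 < Real.log (1 + a) := Real.log_pos (by linarith)
  exact ⟨by positivity, (div_le_one hl1).2 (Real.log_le_log (by linarith) (by linarith))⟩

theorem G_ofReal_nonneg {a : ℝ} (ha : 1 ≤ a) : 0 ≤ G a := by
  rw [G_ofReal (by linarith), Complex.zero_le_real]
  have hl : 0 ≤ Real.log a := Real.log_nonneg ha
  have := (log_div_log_one_add_mem_Icc ha).2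
  exact mul_nonneg (mul_nonneg (by linarith) (by linarith)) hl

/-- `G a` is the product of `a log (1 + 1/a)` and `log a / log (1 + a)`, each at most `1`. -/
theorem G_ofReal_re_le_one {a : ℝ} (ha : 1 ≤ a) : (G a).re ≤ 1 := by
  rw [G_ofReal (by linarith), Complex.ofReal_re]
  obtain ⟨h0, h1⟩ := log_div_log_one_add_mem_Icc ha
  have hl1 : 0 < Real.log (1 + a) := Real.log_pos (by linarith)
  have e : (1 - Real.log a / Real.log (1 + a)) * a * Real.log a
      = (a * (Real.log (1 + a) - Real.log a)) * (Real.log a / Real.log (1 + a)) := by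
    field_simp
  have h2 : a * (Real.log (1 + a) - Real.log a) ≤ 1 := by
    rw [← Real.log_div (by linarith) (by linarith)]
    have := Real.log_le_sub_one_of_pos (x := (1 + a) / a) (by positivity)
    calc _ ≤ a * ((1 + a) / a - 1) := by gcongr
      _ = 1 := by field_simp; ring
  rw [e]
  calc _ ≤ 1 * (Real.log a / Real.log (1 + a)) := by gcongr
    _ ≤ 1 := by linarith

/-- By the Stieltjes formula `a (1 - G a) = ∫ a / (t + a) * rho t`; the kernel tends to `1` and is
dominated by `1`. -/
theorem integral_rho_nonneg : 0 ≤ ∫ t in Ioi (0 : ℝ), rho t := by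
  have hlim : Tendsto (fun a : ℝ => ∫ t in Ioi (0 : ℝ), a / (t + a) * rho t) atTop
      (𝓝 (∫ t in Ioi (0 : ℝ), rho t)) := by
    refine tendsto_integral_filter_of_dominated_convergence (fun t => ‖rho t‖) ?_ ?_
      integrableOn_rho.norm ?_
    · refine Eventually.of_forall fun a => ?_
      exact (by fun_prop : Measurable fun t : ℝ => a / (t + a)).aestronglyMeasurable.mul
        integrableOn_rho.aestronglyMeasurable
    · filter_upwards [eventually_gt_atTop (0 : ℝ)] with a ha
      filter_upwards [ae_restrict_mem measurableSet_Ioi] with t ht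
      have ht' : (0 : ℝ) < t := ht
      rw [norm_mul, Real.norm_of_nonneg (by positivity)]
      refine mul_le_of_le_one_left (norm_nonneg _) ?_
      rw [div_le_one (by positivity)]
      linarith
    · refine ae_of_all _ fun t => ?_
      have h1 : Tendsto (fun a : ℝ => 1 - t / (t + a)) atTop (𝓝 (1 - 0)) :=
        tendsto_const_nhds.sub (tendsto_const_nhds.div_atTop
          (tendsto_atTop_add_const_left _ _ tendsto_id))
      have h2 := h1.mul_const (rho t)
      rw [sub_zero, one_mul] at h2
      refine h2.congr' ?_
      filter_upwards [eventually_gt_atTop (-t)] with a ha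
      have : t + a ≠ 0 := by linarith
      field_simp
      ring
  refine ge_of_tendsto hlim ?_
  filter_upwards [eventually_ge_atTop (1 : ℝ)] with a ha
  have h1 := congrArg Complex.re (one_sub_G_ofReal_eq_integral (show 0 < a by linarith))
  rw [Complex.ofReal_re, Complex.sub_re, Complex.one_re] at h1
  have h2 := G_ofReal_re_le_one ha
  have e : ∀ t : ℝ, a / (t + a) * rho t = a * (rho t / (t + a)) := fun t => by ring
  simp only [e]
  rw [integral_const_mul, ← h1]
  exact mul_nonneg (by linarith) (by linarith)

theorem rho_nonneg_of_sq_add_le {t : ℝ} (h0 : 0 < t) (h : t ^ 2 + t ≤ 1) : 0 ≤ rho t := by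
  have h1 : t < 1 := by nlinarith
  rw [rho, if_pos h1, ← neg_div, neg_div, ← div_neg]
  refine div_nonneg (mul_nonneg h0.le (Real.log_nonneg ?_)) ?_
  · rw [le_div_iff₀ (by positivity)]; linarith
  · linarith [Real.log_nonpos (x := 1 - t) (by linarith) (by linarith)]

theorem rho_nonpos_of_le_sq_add {t : ℝ} (h0 : 0 < t) (h : 1 ≤ t ^ 2 + t) : rho t ≤ 0 := by
  rw [rho]
  split_ifs with h1 h2
  · rw [neg_nonpos]
    refine div_nonneg_of_nonpos (mul_nonpos_of_nonneg_of_nonpos h0.le (Real.log_nonpos ?_ ?_))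
      (Real.log_nonpos (by linarith) (by linarith))
    · exact div_nonneg (by linarith) (by positivity)
    · rw [div_le_one (by positivity)]; linarith
  · norm_num
  · rw [neg_nonpos]
    positivity

theorem phi_nonneg {s : ℝ} (hs : 0 ≤ s) : 0 ≤ phi s := by
  -- `c` is the sign change of `rho`, where `(1 - t) / t ^ 2` crosses `1`.
  obtain ⟨c, hc0, hc⟩ : ∃ c : ℝ, 0 < c ∧ c ^ 2 + c = 1 := by
    have h5 : √5 ^ 2 = (5 : ℝ) := Real.sq_sqrt (by norm_num)
    have h1 : 1 < √(5 : ℝ) := by rw [Real.lt_sqrt] <;> norm_num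
    exact ⟨(√5 - 1) / 2, by linarith, by linear_combination h5 / 4⟩
  have h : ∫ t in Ioi (0 : ℝ), rho t
      ≤ ∫ t in Ioi (0 : ℝ), Real.exp (s * c) * (Real.exp (-s * t) * rho t) := by
    refine setIntegral_mono_on integrableOn_rho ((integrableOn_exp_mul_rho hs).const_mul _)
      measurableSet_Ioi fun t ht => ?_
    have ht' : (0 : ℝ) < t := ht
    -- The weight `exp (s (c - t))` is at least `1` where `rho ≥ 0` and at most `1` where `rho ≤ 0`,
    -- so it can only increase the integrand.
    rw [← mul_assoc, ← Real.exp_add]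
    rcases le_total t c with htc | htc
    · have h1 := rho_nonneg_of_sq_add_le ht' (by nlinarith)
      refine le_mul_of_one_le_left h1 (Real.one_le_exp ?_)
      nlinarith
    · have h1 := rho_nonpos_of_le_sq_add ht' (by nlinarith)
      have h2 : Real.exp (s * c + -s * t) ≤ 1 := Real.exp_le_one_iff.2 (by nlinarith)
      nlinarith
  rw [integral_const_mul] at h
  exact nonneg_of_mul_nonneg_right (integral_rho_nonneg.trans h) (Real.exp_pos _)

/-! ### Fourier representation and definiteness -/

theorem density_nonneg (a s : ℝ) : 0 ≤ density a s :=
  indicator_nonneg (fun _ hs => mul_nonneg (Real.exp_pos _).le (phi_nonneg hs)) s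

theorem integrable_density {a : ℝ} (ha : 0 < a) : Integrable (density a) :=
  (integrable_indicator_iff measurableSet_Ici).2
    ((integrableOn_Ici_iff_integrableOn_Ioi).2 (integrableOn_exp_mul_phi ha))

theorem one_sub_G_eq_fourierTransform {a : ℝ} (ha : 0 < a) (t : ℝ) :
    1 - G (a + t * Complex.I) = fourierTransform (density a) t := by
  rw [one_sub_G_eq_integral ha, fourierTransform, ← integral_Ici_eq_integral_Ioi,
    ← integral_indicator measurableSet_Ici]
  refine integral_congr_ae (ae_of_all _ fun s => ?_)
  by_cases hs : s ∈ Ici (0 : ℝ) <;> simp [density, hs]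

/-- The quadratic form is the integral of `|∑ conj (x i) * e i s|²` against `d`. It serves both
kinds of definiteness, with `e i` an exponential or `1` minus one. -/
theorem posSemidef_integral {n : ℕ} {e : Fin n → ℝ → ℂ} {d : ℝ → ℝ} (hd : ∀ s, 0 ≤ d s)
    (hint : ∀ i j, Integrable fun s => e i s * starRingEnd ℂ (e j s) * (d s : ℂ)) :
    (Matrix.of fun i j => ∫ s, e i s * starRingEnd ℂ (e j s) * (d s : ℂ)).PosSemidef := by
  refine Matrix.PosSemidef.of_dotProduct_mulVec_nonneg ?_ fun x => ?_
  · ext i j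
    rw [Matrix.conjTranspose_apply, Matrix.of_apply, Matrix.of_apply, Complex.star_def,
      ← integral_conj]
    refine integral_congr_ae (ae_of_all _ fun s => ?_)
    simp only [map_mul, Complex.conj_conj, Complex.conj_ofReal]
    ring
  · have h : star x ⬝ᵥ (Matrix.of fun i j =>
        ∫ s, e i s * starRingEnd ℂ (e j s) * (d s : ℂ)).mulVec x
        = ((∫ s, Complex.normSq (∑ i, starRingEnd ℂ (x i) * e i s) * d s : ℝ) : ℂ) := by
      rw [← integral_complex_ofReal]
      simp only [dotProduct, Matrix.mulVec, Matrix.of_apply, Pi.star_apply, Complex.star_def,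
        Finset.mul_sum]
      have e1 : ∀ s, ((Complex.normSq (∑ i, starRingEnd ℂ (x i) * e i s) * d s : ℝ) : ℂ)
          = ∑ i, ∑ j, starRingEnd ℂ (x i) * (x j) *
            (e i s * starRingEnd ℂ (e j s) * (d s : ℂ)) := by
        intro s
        rw [Complex.ofReal_mul, ← Complex.mul_conj, map_sum, Finset.sum_mul_sum, Finset.sum_mul]
        refine Finset.sum_congr rfl fun i _ => ?_
        rw [Finset.sum_mul]
        refine Finset.sum_congr rfl fun j _ => ?_
        rw [map_mul, Complex.conj_conj]
        ring
      simp only [e1]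
      rw [integral_finsetSum _ fun i _ => integrable_finsetSum _ fun j _ =>
        (hint i j).const_mul _]
      refine Finset.sum_congr rfl fun i _ => ?_
      rw [integral_finsetSum _ fun j _ => (hint i j).const_mul _]
      refine Finset.sum_congr rfl fun j _ => ?_
      rw [integral_const_mul]
      ring
    rw [h, Complex.zero_le_real]
    exact integral_nonneg fun s => mul_nonneg (Complex.normSq_nonneg _) (hd s)

theorem integrable_mul_ofReal {f : ℝ → ℂ} {d : ℝ → ℝ} (hd : Integrable d) (hf : Continuous f)
    {C : ℝ} (hC : ∀ s, ‖f s‖ ≤ C) : Integrable fun s => f s * (d s : ℂ) :=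
  (hd.ofReal (𝕜 := ℂ)).bdd_mul hf.aestronglyMeasurable (ae_of_all _ hC)

theorem norm_exp_neg_I_mul_mul (t s : ℝ) : ‖Complex.exp (-(Complex.I * t * s))‖ = 1 := by
  simp [Complex.norm_exp]

theorem conj_exp_neg_I_mul_mul (t s : ℝ) : starRingEnd ℂ (Complex.exp (-(Complex.I * t * s)))
    = Complex.exp (Complex.I * t * s) := by
  simp [← Complex.exp_conj]

theorem isPositiveDefinite_fourierTransform {d : ℝ → ℝ} (hd : ∀ s, 0 ≤ d s)
    (hi : Integrable d) : IsPositiveDefinite (fourierTransform d) := by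
  intro n x
  have h := posSemidef_integral (e := fun (i : Fin n) s => Complex.exp (-(Complex.I * x i * s)))
    hd fun i j => integrable_mul_ofReal hi (C := 1) (by fun_prop) fun s => by
      rw [norm_mul, RCLike.norm_conj, norm_exp_neg_I_mul_mul, norm_exp_neg_I_mul_mul, one_mul]
  convert h using 4 with i j
  rw [fourierTransform]
  congr 1
  ext s
  rw [conj_exp_neg_I_mul_mul, ← Complex.exp_add]
  push_cast
  ring_nf

theorem isNegativeDefinite_fourierTransform_zero_sub {d : ℝ → ℝ} (hd : ∀ s, 0 ≤ d s)
    (hi : Integrable d) :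
    IsNegativeDefinite fun t => fourierTransform d 0 - fourierTransform d t := by
  intro n x
  have hb : ∀ t s : ℝ, ‖1 - Complex.exp (-(Complex.I * t * s))‖ ≤ 2 := fun t s =>
    (norm_sub_le _ _).trans (by rw [norm_exp_neg_I_mul_mul, norm_one]; norm_num)
  have hE : ∀ t : ℝ, Integrable fun s : ℝ => Complex.exp (-(Complex.I * t * s)) * (d s : ℂ) :=
    fun t => integrable_mul_ofReal hi (C := 1) (by fun_prop) fun s =>
      (norm_exp_neg_I_mul_mul t s).le
  have h := posSemidef_integral
    (e := fun (i : Fin n) s => 1 - Complex.exp (-(Complex.I * x i * s)))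
    hd fun i j => integrable_mul_ofReal hi (C := 4) (by fun_prop) fun s => by
      rw [norm_mul, RCLike.norm_conj]
      have h1 := hb (x i) s
      have h2 := hb (x j) s
      nlinarith [norm_nonneg (1 - Complex.exp (-(Complex.I * x i * s))),
        norm_nonneg (1 - Complex.exp (-(Complex.I * x j * s)))]
  have hsub : ∀ t : ℝ, fourierTransform d 0 - fourierTransform d t
      = ∫ s : ℝ, (1 - Complex.exp (-(Complex.I * t * s))) * (d s : ℂ) := by
    intro t
    rw [fourierTransform, fourierTransform, ← integral_sub (hE 0) (hE t)]
    congr 1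
    ext s
    simp [sub_mul]
  have hI : ∀ t : ℝ, Integrable fun s : ℝ =>
      (1 - Complex.exp (-(Complex.I * t * s))) * (d s : ℂ) := fun t =>
    integrable_mul_ofReal hi (by fun_prop) (hb t)
  have hIc : ∀ t : ℝ, Integrable fun s : ℝ =>
      (1 - Complex.exp (Complex.I * t * s)) * (d s : ℂ) := fun t => by
    simpa using hI (-t)
  convert h using 4 with i j
  simp only [hsub]
  rw [← integral_conj]
  simp only [map_mul, map_sub, map_one, conj_exp_neg_I_mul_mul, Complex.conj_ofReal]
  have hsum : Integrable fun s : ℝ => (1 - Complex.exp (-(Complex.I * x i * s))) * (d s : ℂ)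
      + (1 - Complex.exp (Complex.I * x j * s)) * (d s : ℂ) := (hI _).add (hIc _)
  rw [← integral_add (hI _) (hIc _), ← integral_sub hsum (hI _)]
  congr 1
  ext s
  -- With `u = exp (-i x_i s)` and `v = exp (i x_j s)`, what remains is `(1 - u) + (1 - v) - (1 - u
  -- v) = (1 - u)(1 - v)`.
  have e : Complex.exp (-(Complex.I * (x i - x j : ℝ) * s))
      = Complex.exp (-(Complex.I * x i * s)) * Complex.exp (Complex.I * x j * s) := by
    rw [← Complex.exp_add]; push_cast; ring_nf
  rw [e]
  ring

theorem IsNegativeDefinite.add_const {f : ℝ → ℂ} (hf : IsNegativeDefinite f) {c : ℝ}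
    (hc : 0 ≤ c) : IsNegativeDefinite fun t => f t + c := by
  intro n x
  have h1 : (Matrix.of fun _ _ : Fin n => (c : ℂ)).PosSemidef := by
    have : (Matrix.of fun _ _ : Fin n => (c : ℂ))
        = (c : ℂ) • Matrix.vecMulVec (fun _ : Fin n => (1 : ℂ)) (star fun _ => 1) := by
      ext i j; simp [Matrix.vecMulVec]
    rw [this]
    exact (Matrix.posSemidef_vecMulVec_self_star _).smul (Complex.zero_le_real.2 hc)
  convert (hf n x).add h1 using 1
  ext i j
  simp
  ring

/-- The `1 × 1` matrix at the point `t` has entry `2 Re f(t) - f(0)`. -/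
theorem IsNegativeDefinite.re_nonneg {f : ℝ → ℂ} (hf : IsNegativeDefinite f) (h0 : f 0 = 0)
    (t : ℝ) : 0 ≤ (f t).re := by
  have h := (hf 1 fun _ => t).diag_nonneg (i := 0)
  simp only [Matrix.of_apply, sub_self, h0, sub_zero, Complex.add_conj] at h
  have := Complex.zero_le_real.1 h
  linarith

theorem analyticOnNhd_one_sub_G_vertical {a : ℝ} (ha : 0 < a) :
    AnalyticOnNhd ℝ (fun t : ℝ => 1 - G (a + t * Complex.I)) univ := by
  intro t _
  have hd : DifferentiableOn ℂ (fun w => 1 - G w) Complex.slitPlane := fun w hw =>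
    ((differentiableAt_const _).sub (differentiableAt_G hw)).differentiableWithinAt
  have h1 := (hd.analyticAt (Complex.isOpen_slitPlane.mem_nhds
    (ofReal_add_mul_I_mem_slitPlane ha t))).restrictScalars (𝕜 := ℝ)
  have h2 : AnalyticAt ℝ (fun t : ℝ => (a + t * Complex.I : ℂ)) t :=
    analyticAt_const.add ((Complex.ofRealCLM.analyticAt t).mul analyticAt_const)
  exact h1.comp (f := fun t : ℝ => (a + t * Complex.I : ℂ)) h2

theorem isNegativeDefinite_G_vertical_sub {a : ℝ} (ha : 0 < a) :
    IsNegativeDefinite fun t : ℝ => G (a + t * Complex.I) - G a := by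
  have h := isNegativeDefinite_fourierTransform_zero_sub (density_nonneg a)
    (integrable_density ha)
  simp only [← one_sub_G_eq_fourierTransform ha] at h
  simpa using h

end AlzerG

end

theorem mainTheorem3 :
    -- the integral defining `φ(s)` converges absolutely for every `s ≥ 0`
    (∀ s : ℝ, 0 ≤ s →
      IntegrableOn (fun t : ℝ => Real.exp (-s * t) * AlzerG.rho t) (Ioi 0)) ∧
    -- (i)
    (∀ a : ℝ, 0 < a →
      AnalyticOnNhd ℝ (fun t : ℝ => 1 - AlzerG.G (a + t * Complex.I)) univ ∧
      AlzerG.IsPositiveDefinite (fun t : ℝ => 1 - AlzerG.G (a + t * Complex.I)) ∧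
      Integrable (AlzerG.density a) ∧
      (∀ t : ℝ, 1 - AlzerG.G (a + t * Complex.I) =
        AlzerG.fourierTransform (AlzerG.density a) t) ∧
      (∀ t : ℝ, 1 - AlzerG.G (a + t * Complex.I) =
        ∫ s in Ioi (0 : ℝ), Complex.exp (-(Complex.I * t * s)) *
          (Real.exp (-a * s) * AlzerG.phi s : ℝ))) ∧
    -- (ii)
    (∀ a : ℝ, 0 < a →
      Continuous (fun t : ℝ => AlzerG.G (a + t * Complex.I) - AlzerG.G a) ∧
      AlzerG.IsNegativeDefinite (fun t : ℝ => AlzerG.G (a + t * Complex.I) - AlzerG.G a) ∧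
      (AlzerG.G a).im = 0 ∧
      (∀ t : ℝ, (AlzerG.G a).re ≤ (AlzerG.G (a + t * Complex.I)).re)) ∧
    -- (iii)
    (∀ a : ℝ, 1 ≤ a →
      Continuous (fun t : ℝ => AlzerG.G (a + t * Complex.I)) ∧
      AlzerG.IsNegativeDefinite (fun t : ℝ => AlzerG.G (a + t * Complex.I))) := by
  refine ⟨fun s hs => AlzerG.integrableOn_exp_mul_rho hs, fun a ha => ?_, fun a ha => ?_,
    fun a ha => ?_⟩
  · refine ⟨AlzerG.analyticOnNhd_one_sub_G_vertical ha, ?_, AlzerG.integrable_density ha,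
      AlzerG.one_sub_G_eq_fourierTransform ha, AlzerG.one_sub_G_eq_integral ha⟩
    simp only [AlzerG.one_sub_G_eq_fourierTransform ha]
    exact AlzerG.isPositiveDefinite_fourierTransform (AlzerG.density_nonneg a)
      (AlzerG.integrable_density ha)
  · have hneg := AlzerG.isNegativeDefinite_G_vertical_sub ha
    refine ⟨(AlzerG.continuous_G_vertical ha).sub continuous_const, hneg, ?_, fun t => ?_⟩
    · rw [AlzerG.G_ofReal ha, Complex.ofReal_im]
    · simpa using hneg.re_nonneg (by simp) t
  · have ha0 : 0 < a := by linarith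
    refine ⟨AlzerG.continuous_G_vertical ha0, ?_⟩
    obtain ⟨c, hc0, hc⟩ : ∃ c : ℝ, 0 ≤ c ∧ AlzerG.G a = c := by
      have h := AlzerG.G_ofReal_nonneg ha
      rw [AlzerG.G_ofReal ha0] at h ⊢
      exact ⟨_, Complex.zero_le_real.1 h, rfl⟩
    have h := (AlzerG.isNegativeDefinite_G_vertical_sub ha0).add_const hc0
    simpa only [hc, sub_add_cancel] using h
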